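/- Let $E$ be an elliptic curve over $\mathbb{Q}$ whose conductor is of the form $2^r M$ with $r \geq 0$ and $M$ an odd squarefree positive integer. Then the $2$-torsion $E[2]$, viewed as a $2$-dimensional representation over $\mathbb{F}_2$ of the absolute Galois group $\mathrm{Gal}(\overline{\mathbb{Q}}/\mathbb{Q})$, is either reducible or absolutely irreducible (that is, irreducible after extension of scalars to $\overline{\mathbb{F}}_2$). Moreover, the field $\mathbb{Q}(E[2])$ generated by the coordinates of the $2$-torsion points of $E$ does not have degree $3$ over $\mathbb{Q}$; in particular it is not a cyclic cubic extension of $\mathbb{Q}$. -/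

import Mathlib

open scoped NumberField TensorProduct

noncomputable section

/-! ### Reducible and absolutely irreducible representations -/

namespace Representation

variable {k G V : Type*} [Field k] [Group G] [AddCommGroup V] [Module k V]

/-- `ρ` is reducible: there is an invariant subspace other than `0` and the whole space. -/
def IsReducible (ρ : Representation k G V) : Prop :=
  ∃ U : Subrepresentation ρ, U.toSubmodule ≠ ⊥ ∧ U.toSubmodule ≠ ⊤

/-- The representation of `G` on `F ⊗ V` obtained from `ρ` by extending scalars to `F`. -/
def extendScalars (F : Type*) [Field F] [Algebra k F] (ρ : Representation k G V) :
    Representation F G (F ⊗[k] V) where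
  toFun g := (ρ g).baseChange F
  map_one' := by
    rw [map_one]
    exact LinearMap.baseChange_id
  map_mul' g h := by
    rw [map_mul]
    exact LinearMap.baseChange_comp (ρ h) (ρ g)

/-- `ρ` is absolutely irreducible: it is irreducible over an algebraic closure of `k`. -/
def IsAbsolutelyIrreducible (ρ : Representation k G V) : Prop :=
  (ρ.extendScalars (AlgebraicClosure k)).IsIrreducible

end Representation

/-! ### The localization of `ℤ` at a prime, as a subring of `ℚ` -/

/-- The ring of rational numbers whose denominator is prime to `p`. -/
abbrev RatLocalRing (p : ℕ) [Fact p.Prime] : ValuationSubring ℚ :=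
  (Rat.padicValuation p).valuationSubring

instance RatLocalRing.isDiscreteValuationRing (p : ℕ) [Fact p.Prime] :
    IsDiscreteValuationRing (RatLocalRing p) := by
  have : Nontrivial (MonoidWithZeroHom.ofClass (Rat.padicValuation p)).valueGroup := by
    rw [Subgroup.nontrivial_iff_exists_ne_one]
    refine ⟨Units.mk0 (Rat.padicValuation p p) (by simp), ?_, ?_⟩
    · apply MonoidWithZeroHom.mem_valueGroup
      exact ⟨p, rfl⟩
    · intro h
      have h1 := congrArg Units.val h
      rw [Units.val_mk0, Rat.padicValuation_self, Units.val_one, ← WithZero.exp_zero,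
        WithZero.exp_injective.eq_iff] at h1
      omega
  exact (Rat.padicValuation p).valuationSubring_isDiscreteValuationRing

namespace WeierstrassCurve

/-! ### Torsion points as Galois representations -/

section Torsion

open scoped Classical in
/-- The group `E(F)[n]` of points of order dividing `n` over an extension `F` of `K`. -/
abbrev nTorsion {K : Type*} [Field K] (E : WeierstrassCurve K) (n : ℕ)
    (F : Type*) [Field F] [Algebra K F] : AddSubgroup (E⁄F).toAffine.Point :=
  AddSubgroup.torsionBy (E⁄F).toAffine.Point (n : ℤ)

open scoped Classical in
instance nTorsion.zmodModule {K : Type*} [Field K] (E : WeierstrassCurve K) (n : ℕ)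
    (F : Type*) [Field F] [Algebra K F] : Module (ZMod n) (E.nTorsion n F) :=
  AddSubgroup.torsionBy.zmodModule

open scoped Classical in
/-- The additive map that an automorphism `σ` of `F` over `K` induces on `E(F)[n]` by acting on
the coordinates of points. -/
def nTorsionMap {K : Type*} [Field K] (E : WeierstrassCurve K) (n : ℕ)
    (F : Type*) [Field F] [Algebra K F] (σ : Gal(F/K)) : E.nTorsion n F →+ E.nTorsion n F :=
  AddMonoidHom.codRestrict
    ((Affine.Point.map (W' := E.toAffine) (σ : F →ₐ[K] F)).comp (E.nTorsion n F).subtype)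
    (E.nTorsion n F)
    (fun P => by
      rw [AddSubgroup.torsionBy.nsmul_iff]
      have h : n • (P : (E⁄F).toAffine.Point) = 0 := AddSubgroup.torsionBy.nsmul_iff.mp P.2
      rw [AddMonoidHom.comp_apply, AddSubgroup.subtype_apply]
      refine (map_nsmul _ _ _).symm.trans ?_
      rw [h]
      exact map_zero _)

/-- The `ℤ/nℤ`-linear representation of the Galois group of `F` over `K` on `E(F)[n]`. -/
def nTorsionRep {K : Type*} [Field K] (E : WeierstrassCurve K) (n : ℕ)
    (F : Type*) [Field F] [Algebra K F] :
    Representation (ZMod n) Gal(F/K) (E.nTorsion n F) where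
  toFun σ := (E.nTorsionMap n F σ).toZModLinearMap n
  map_one' := by
    ext P
    obtain ⟨P, hP⟩ := P
    cases P <;> rfl
  map_mul' σ τ := by
    ext P
    obtain ⟨P, hP⟩ := P
    cases P <;> rfl

end Torsion

section Rational

variable (E : WeierstrassCurve ℚ)

/-- The mod `n` Galois representation of `E`, on `E[n]` over an algebraic closure of `ℚ`. -/
abbrev galoisRep (n : ℕ) : Representation (ZMod n) Gal(AlgebraicClosure ℚ/ℚ)
    (E.nTorsion n (AlgebraicClosure ℚ)) :=
  E.nTorsionRep n (AlgebraicClosure ℚ)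

/-- The field `ℚ(E[n])` generated by the coordinates of the nonzero points in `E[n]`. -/
def divisionField (n : ℕ) : IntermediateField ℚ (AlgebraicClosure ℚ) :=
  IntermediateField.adjoin ℚ
    {z | ∃ (x y : AlgebraicClosure ℚ)
      (h : (E⁄(AlgebraicClosure ℚ)).toAffine.Nonsingular x y),
      Affine.Point.some x y h ∈ E.nTorsion n (AlgebraicClosure ℚ) ∧ (z = x ∨ z = y)}

/-! ### The conductor -/

/-- The `i`-th ramification group (lower numbering) at the prime `P` of the extension `L` of `ℚ`:
the automorphisms of `L` that act trivially modulo `P ^ (i + 1)` on the ring of integers. -/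
def ramificationGroup {L : Type*} [Field L] [Algebra ℚ L] (P : Ideal (𝓞 L)) (i : ℕ) :
    Subgroup Gal(L/ℚ) :=
  (P ^ (i + 1)).inertia Gal(L/ℚ)

/-- The codimension of the subspace of `E[n]` fixed by a group `H` of automorphisms of
`ℚ(E[n])`. -/
def fixedCodim (n : ℕ) (H : Subgroup Gal(E.divisionField n/ℚ)) : ℕ :=
  Module.finrank (ZMod n) (E.nTorsion n (E.divisionField n) ⧸
    Representation.invariants ((E.nTorsionRep n (E.divisionField n)).comp H.subtype))

/-- The Swan conductor at `P` of the representation on `E[n]`, namely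
`∑_{i ≥ 1} (|G_i| / |G_0|) dim (E[n] / E[n]^{G_i})` with `G_i` the ramification groups at `P` of
`ℚ(E[n]) / ℚ`. -/
def swanConductor (n : ℕ) (P : Ideal (𝓞 (E.divisionField n))) : ℚ :=
  ∑ᶠ i : ℕ, (Nat.card (ramificationGroup P (i + 1)) : ℚ) / Nat.card (ramificationGroup P 0) *
    E.fixedCodim n (ramificationGroup P (i + 1))

/-- The rational prime `p` lies under some maximal ideal of any ring of algebraic integers. -/
theorem exists_prime_above (L : Type*) [Field L] [CharZero L] (p : ℕ) [Fact p.Prime] :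
    ∃ P : Ideal (𝓞 L), P.IsMaximal ∧ P.LiesOver (Ideal.span {(p : ℤ)}) := by
  have : (Ideal.span {(p : ℤ)}).IsMaximal := Int.ideal_span_isMaximal_of_prime p
  exact Ideal.exists_maximal_ideal_liesOver_of_isIntegral (Ideal.span {(p : ℤ)})

/-- The wild part of the exponent of the conductor at `p`: the Swan conductor of `E[ℓ]` at a prime
above `p`, for a prime `ℓ ≠ p`. It depends neither on `ℓ`, for which the least possibility is
taken, nor on the prime above `p`. -/
def wildExponent (p : ℕ) [Fact p.Prime] : ℚ :=
  E.swanConductor (if p = 2 then 3 else 2)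
    (exists_prime_above (E.divisionField (if p = 2 then 3 else 2)) p).choose

open scoped Classical in
/-- The exponent of the conductor of `E` at `p`, determined by the reduction of a minimal
Weierstrass equation at `p`: it is `0` for good reduction, `1` for multiplicative reduction, and
`2 + δ` for additive reduction, where `δ` is the wild part. Since `δ` is a nonnegative integer,
taking the integer part only serves to have a natural number. -/
def conductorExponent (p : ℕ) [Fact p.Prime] : ℕ :=
  if (E.minimal (RatLocalRing p)).HasGoodReduction (RatLocalRing p) then 0
  else if (E.minimal (RatLocalRing p)).HasMultiplicativeReduction (RatLocalRing p) then 1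
  else 2 + ⌊E.wildExponent p⌋₊

/-- Only finitely many primes contribute to the conductor. -/
theorem finite_mulSupport_conductor [E.IsElliptic] :
    (Function.mulSupport fun p : Nat.Primes =>
      haveI : Fact (p : ℕ).Prime := ⟨p.2⟩; (p : ℕ) ^ E.conductorExponent p).Finite := by
  set D : ℕ := E.a₁.den * E.a₂.den * E.a₃.den * E.a₄.den * E.a₆.den * E.Δ.num.natAbs with hD
  have hΔ : E.Δ ≠ 0 := E.isUnit_Δ.ne_zero
  have hD0 : D ≠ 0 := by
    simp [hD, hΔ]
  refine Set.Finite.subset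
    (Set.Finite.preimage Subtype.val_injective.injOn D.primeFactors.finite_toSet) ?_
  intro p hp
  by_contra hpD
  apply hp
  have : Fact (p : ℕ).Prime := ⟨p.2⟩
  have hdvd : ¬ (p : ℕ) ∣ D := fun h => hpD (by
    simpa [hD0] using And.intro p.2 h)
  have hd : ∀ n, n ∣ D → ¬ (p : ℕ) ∣ n := fun n hn h => hdvd (h.trans hn)
  have hmem : ∀ x : ℚ, x.den ∣ D → ∃ r : RatLocalRing p, algebraMap (RatLocalRing p) ℚ r = x :=
    fun x hx => ⟨⟨x, Rat.padicValuation_le_one_iff.mpr (hd _ hx)⟩, rfl⟩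
  have hint : E.IsIntegral (RatLocalRing p) := by
    refine isIntegral_of_exists_lift _ (hmem _ ?_) (hmem _ ?_) (hmem _ ?_) (hmem _ ?_) (hmem _ ?_)
    · exact ⟨E.a₂.den * E.a₃.den * E.a₄.den * E.a₆.den * E.Δ.num.natAbs, by rw [hD]; ring⟩
    · exact ⟨E.a₁.den * E.a₃.den * E.a₄.den * E.a₆.den * E.Δ.num.natAbs, by rw [hD]; ring⟩
    · exact ⟨E.a₁.den * E.a₂.den * E.a₄.den * E.a₆.den * E.Δ.num.natAbs, by rw [hD]; ring⟩
    · exact ⟨E.a₁.den * E.a₂.den * E.a₃.den * E.a₆.den * E.Δ.num.natAbs, by rw [hD]; ring⟩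
    · exact ⟨E.a₁.den * E.a₂.den * E.a₃.den * E.a₄.den * E.Δ.num.natAbs, by rw [hD]; ring⟩
  obtain ⟨d, hdΔ⟩ := Δ_integral_of_isIntegral (RatLocalRing p) E
  have hinv : ∃ r : RatLocalRing p, algebraMap (RatLocalRing p) ℚ r = E.Δ⁻¹ := by
    refine ⟨⟨E.Δ⁻¹, Rat.padicValuation_le_one_iff.mpr ?_⟩, rfl⟩
    rw [Rat.inv_def]
    intro h
    refine hd E.Δ.num.natAbs ⟨_, mul_comm _ _⟩ (h.trans ?_)
    exact Int.natCast_dvd.mp (Rat.den_dvd _ _)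
  obtain ⟨e, he⟩ := hinv
  have hunit : IsUnit d := IsUnit.of_mul_eq_one e (by
    apply IsFractionRing.injective (RatLocalRing p) ℚ
    rw [map_mul, hdΔ, he, map_one, mul_inv_cancel₀ hΔ])
  have hv : (IsDiscreteValuationRing.maximalIdeal (RatLocalRing p)).valuation ℚ E.Δ = 1 := by
    rw [← hdΔ]
    refine le_antisymm (IsDedekindDomain.HeightOneSpectrum.valuation_le_one _ _) ?_
    rw [← not_lt, IsDedekindDomain.HeightOneSpectrum.valuation_lt_one_iff_mem]
    exact fun h => (IsLocalRing.mem_maximalIdeal _).mp h hunit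
  have hgood : (E.minimal (RatLocalRing p)).HasGoodReduction (RatLocalRing p) := by
    refine ⟨?_⟩
    have hmin := (inferInstance :
      (E.minimal (RatLocalRing p)).IsMinimal (RatLocalRing p)).val_Δ_maximal
    set C := (E.exists_isMinimal (RatLocalRing p)).choose with hC
    have hCE : C⁻¹ • E.minimal (RatLocalRing p) = E := inv_smul_smul C E
    have h1 := hmin.2 (j := C⁻¹) (by simpa only [hCE] using hint)
    have hmax : valuation_Δ_aux (RatLocalRing p) E ≤
        valuation_Δ_aux (RatLocalRing p) (E.minimal (RatLocalRing p)) := by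
      simp only [hCE, one_smul] at h1
      refine (le_total _ _).elim id h1
    have h2 : (valuation_Δ_aux (RatLocalRing p) E : WithZero (Multiplicative ℤ)) ≤
        valuation_Δ_aux (RatLocalRing p) (E.minimal (RatLocalRing p)) := hmax
    rw [valuation_Δ_aux_eq_of_isIntegral, valuation_Δ_aux_eq_of_isIntegral, hv] at h2
    refine le_antisymm ?_ h2
    rw [← integralModel_Δ_eq (RatLocalRing p)]
    exact IsDedekindDomain.HeightOneSpectrum.valuation_le_one _ _
  show (p : ℕ) ^ E.conductorExponent p = 1
  rw [conductorExponent, if_pos hgood, pow_zero]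

/-- The conductor of `E`: the product of `p ^ f_p` over all primes `p`, where `f_p` is the
exponent of the conductor at `p`, which vanishes for all but finitely many `p`. -/
def conductor : ℕ :=
  ∏ᶠ p : Nat.Primes, haveI : Fact (p : ℕ).Prime := ⟨p.2⟩; (p : ℕ) ^ E.conductorExponent p

end Rational

end WeierstrassCurve

end

open scoped NumberField TensorProduct
open IsDedekindDomain

noncomputable section

/-! ### Tame ramification with residue field of two elements -/

section Tame

variable {S G : Type*} [CommRing S] [Group G] [MulSemiringAction G S]

/-! Galois acts on E[2] through permutations of its three nonzero points, that is, of the roots `e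
0`, `e 1`, `e 2` of 4x³ + b₂x² + 2b₄x + b₆. If E[2] is irreducible this action is transitive, and a
transposition in the image then gives absolute irreducibility
(`isAbsolutelyIrreducible_of_transposition`). Without transpositions the image is cyclic of order 3
and ℚ(E[2]) is cubic (`finrank_adjoin_eq_three`). So both claims reduce to excluding degree 3.

Suppose L = ℚ(E[2]) has degree 3. It is cyclic cubic, so by Minkowski some prime p ramifies, totally
since the degree is prime. It is not 2: total ramification makes the residue field F₂, whose unit
group is trivial and leaves no room for tame inertia, while wild inertia is a 2-group
(`Ideal.smul_eq_of_mem_inertia_of_pow_three`). For odd p the roots of a minimal equation are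
integral above p, and inertia permutes them cyclically while acting trivially on residues. Hence
they are all congruent, p divides Δ and c₄, the reduction is additive, and p² divides the conductor
(`TwoTorsionRoots.two_le_conductorExponent`), against squarefreeness of M. -/

theorem Ideal.smul_sub_mem_pow_succ {P : Ideal S} {g : G} {n : ℕ}
    (h2 : ∀ x ∈ P, g • x - x ∈ P ^ (n + 2)) :
    ∀ m, ∀ x ∈ P ^ (m + 1), g • x - x ∈ P ^ (n + m + 2) := by
  intro m
  induction m with
  | zero => intro x hx; exact h2 x (by simpa using hx)
  | succ m ih =>
    intro x hx
    rw [pow_succ] at hx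
    refine Submodule.mul_induction_on hx ?_ ?_
    · intro a ha b hb
      -- Leibniz rule for the twisted derivation g - 1: each factor from P contributes one more
      -- power of P.
      have key : g • (a * b) - a * b = (g • a - a) * b + (g • a) * (g • b - b) := by
        rw [smul_mul']; ring
      have hga : g • a ∈ P ^ (m + 1) := by
        have h3 : g • a - a ∈ P ^ (m + 1) := Ideal.pow_le_pow_right (by omega) (ih a ha)
        simpa using add_mem h3 ha
      rw [key]
      refine add_mem ?_ ?_
      · have := Ideal.mul_mem_mul (ih a ha) hb
        rw [← pow_succ] at this
        exact Ideal.pow_le_pow_right (by omega) this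
      · have := Ideal.mul_mem_mul hga (h2 b hb)
        rw [← pow_add] at this
        exact Ideal.pow_le_pow_right (by omega) this
    · intro a b ha hb
      have : g • (a + b) - (a + b) = (g • a - a) + (g • b - b) := by rw [smul_add]; ring
      rw [this]
      exact add_mem ha hb

/-- An automorphism of order `3` that acts trivially modulo a prime with residue field of two
elements is trivial: there is no wild inertia of order `3` in residue characteristic `2`. -/
theorem Ideal.smul_eq_of_mem_inertia_of_pow_three [IsDedekindDomain S]
    {P : Ideal S} [P.IsPrime] (hP : P ≠ ⊥) (hres : ∀ x : S, x ∈ P ∨ x - 1 ∈ P)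
    {g : G} (hg3 : g ^ 3 = 1) (hg : g ∈ P.inertia G) (x : S) : g • x = x := by
  have hg : ∀ x : S, g • x - x ∈ P := hg
  have h1P : (1 : S) ∉ P := fun h => Ideal.IsPrime.ne_top' ((Ideal.eq_top_iff_one P).mpr h)
  have h2P : (2 : S) ∈ P := by
    rcases hres 2 with h | h
    · exact h
    · exact absurd (by convert h using 1; norm_num) h1P
  have step0 : ∀ x ∈ P, g • x - x ∈ P ^ 2 := by
    intro x hx
    have hgP : ∀ y ∈ P, g • y ∈ P := fun y hy => by simpa using add_mem (hg y) hy
    have hgP2 : ∀ y ∈ P ^ 2, g • y ∈ P ^ 2 := by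
      intro y hy
      rw [pow_two] at hy ⊢
      refine Submodule.mul_induction_on hy ?_ ?_
      · intro a ha b hb
        rw [smul_mul']
        exact Ideal.mul_mem_mul (hgP a ha) (hgP b hb)
      · intro a b ha hb
        rw [smul_add]
        exact add_mem ha hb
    by_cases hx2 : x ∈ P ^ 2
    · exact sub_mem (hgP2 x hx2) hx2
    -- P / P² is a line over the residue field F₂, generated by x, so g acts on it by a scalar d
    -- equal to 0 or 1; the value 0 is impossible because g is invertible.
    · obtain ⟨d, e, he, hde⟩ := Ideal.exists_mul_add_mem_pow_succ hP (i := 1) x (g • x)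
        (by simpa using hx) hx2 (by simpa using hgP x hx)
      rcases hres d with hd | hd
      · exfalso
        have hgx : g • x ∈ P ^ 2 := by
          rw [← hde, pow_two]
          exact add_mem (Ideal.mul_mem_mul hx hd) (by simpa [pow_two] using he)
        have h3 : g • (g • (g • x)) = x := by
          rw [smul_smul, smul_smul, ← pow_two, ← pow_succ, hg3, one_smul]
        exact hx2 (h3 ▸ hgP2 _ (hgP2 _ hgx))
      · rw [← hde]
        have : x * d + e - x = x * (d - 1) + e := by ring
        rw [this]
        refine add_mem ?_ he
        rw [pow_two]
        exact Ideal.mul_mem_mul hx hd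
  have step : ∀ n, (∀ x : S, g • x - x ∈ P ^ (n + 1)) ∧ ∀ x ∈ P, g • x - x ∈ P ^ (n + 2) := by
    intro n
    induction n with
    | zero => exact ⟨by simpa using hg, step0⟩
    | succ n ih =>
      have hall : ∀ x : S, g • x - x ∈ P ^ (n + 2) := by
        intro x
        rcases hres x with hx | hx
        · exact ih.2 x hx
        · have := ih.2 _ hx
          rw [smul_sub, smul_one] at this
          convert this using 1
          ring
      refine ⟨hall, fun x hx => ?_⟩
      have hstep := Ideal.smul_sub_mem_pow_succ ih.2
      have hD : ∀ y ∈ P ^ (n + 2), g • y - y ∈ P ^ (n + 3) := fun y hy =>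
        Ideal.pow_le_pow_right (by omega) (hstep (n + 1) y hy)
      have h3 : g • (g • (g • x)) = x := by
        rw [smul_smul, smul_smul, ← pow_two, ← pow_succ, hg3, one_smul]
      set D : S := g • x - x with hDdef
      have hDm : D ∈ P ^ (n + 2) := hall x
      have hD2 := hD D hDm
      set D2 : S := g • D - D with hD2def
      have hD3 := hD D2 (Ideal.pow_le_pow_right (by omega) hD2)
      -- With N = g - 1, this is (1 + N)³ = 1 applied to x. As 2 ∈ P, the coefficient 3 is a unit
      -- modulo P, so D lies as deep as the remaining terms.
      have hsum : 3 * D + 3 * D2 + (g • D2 - D2) = 0 := by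
        have e1 : g • x = x + D := by rw [hDdef]; ring
        have e2 : g • D = D + D2 := by rw [hD2def]; ring
        rw [e1, smul_add, e1, e2, smul_add, smul_add, smul_add, e1, e2] at h3
        linear_combination h3
      have h2D : 2 * D ∈ P ^ (n + 3) := by
        rw [pow_succ']
        exact Ideal.mul_mem_mul h2P hDm
      have : D = -(2 * D + 3 * D2 + (g • D2 - D2)) := by linear_combination hsum
      rw [show n + 1 + 2 = n + 3 by ring, this]
      exact neg_mem (add_mem (add_mem h2D (Ideal.mul_mem_left _ _ hD2)) hD3)
  -- Krull's intersection theorem: an element in every power of P is zero.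
  have hmem : g • x - x ∈ (⨅ i : ℕ, P ^ i) := by
    rw [Submodule.mem_iInf]
    intro i
    exact Ideal.pow_le_pow_right (by omega) ((step i).1 x)
  rw [Ideal.iInf_pow_eq_bot_of_isDomain P Ideal.IsPrime.ne_top'] at hmem
  exact sub_eq_zero.mp hmem

end Tame

/-! ### Cyclic cubic number fields -/

/-- In a cyclic cubic field some odd prime is totally ramified. -/
theorem NumberField.exists_odd_prime_inertia_eq_top (L : Type*) [Field L] [NumberField L]
    [IsGalois ℚ L] (h3 : Module.finrank ℚ L = 3) :
    ∃ p : ℕ, p.Prime ∧ p ≠ 2 ∧ ∃ P : Ideal (𝓞 L), P.IsMaximal ∧ (p : 𝓞 L) ∈ P ∧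
      P.inertia Gal(L/ℚ) = ⊤ := by
  obtain ⟨p, hp, hram⟩ := NumberField.exists_not_isUnramifiedAt_int_of_isGalois (K := L)
    (𝒪 := 𝓞 L) (by omega)
  have : Fact p.Prime := ⟨hp⟩
  have hpi : Prime (p : ℤ) := Nat.prime_iff_prime_int.mp hp
  have : (Ideal.span {(p : ℤ)}).IsMaximal := Int.ideal_span_isMaximal_of_prime p
  obtain ⟨P, hPmax, hPover⟩ := WeierstrassCurve.exists_prime_above L p
  have hpP : (p : 𝓞 L) ∈ P := by
    simpa using (Ideal.liesOver_span_iff Ideal.IsPrime.ne_top' hpi).mp hPover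
  have hcard : Nat.card Gal(L/ℚ) = 3 := by rw [IsGalois.card_aut_eq_finrank, h3]
  have hP0 : P ≠ ⊥ := by
    rintro rfl
    simp [hp.ne_zero] at hpP
  have hinert : P.inertia Gal(L/ℚ) = ⊤ := by
    have : Fact (Nat.card Gal(L/ℚ)).Prime := ⟨by rw [hcard]; norm_num⟩
    refine (Subgroup.eq_bot_or_eq_top_of_prime_card _).resolve_left fun hbot => ?_
    have h1 := Ideal.card_inertia_eq_ramificationIdxIn (G := Gal(L/ℚ)) (Ideal.span {(p : ℤ)}) P
    rw [hbot, Ideal.ramificationIdxIn_eq_ramificationIdx _ P Gal(L/ℚ)] at h1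
    exact hram P inferInstance hpP (Ideal.ramificationIdx_eq_one_iff.mp (by simpa using h1.symm))
  refine ⟨p, hp, ?_, P, hPmax, hpP, hinert⟩
  rintro rfl
  -- Inertia already accounts for the full degree 3, which forces a single prime above 2 with
  -- residue degree 1.
  have hdeg : P.inertiaDeg ℤ = 1 := by
    have h := Ideal.ncard_primesOver_mul_card_inertia_mul_finrank (G := Gal(L/ℚ))
      (Ideal.span {((2 : ℕ) : ℤ)}) P
    rw [hinert, Subgroup.card_top, hcard] at h
    have h' : ((Ideal.span {((2 : ℕ) : ℤ)}).primesOver (𝓞 L)).ncard * P.inertiaDeg ℤ = 1 := by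
      nlinarith
    exact Nat.eq_one_of_mul_eq_one_left h'
  have hnorm : Nat.card (𝓞 L ⧸ P) = 2 := by
    have h := Ideal.absNorm_eq_pow_inertiaDeg' (p := 2) P hp
    rwa [Ideal.inertiaDeg'_eq_inertiaDeg, hdeg, pow_one, Ideal.absNorm_apply,
      Submodule.cardQuot_apply] at h
  have hres : ∀ x : 𝓞 L, x ∈ P ∨ x - 1 ∈ P := by
    intro x
    have : Nontrivial (𝓞 L ⧸ P) := Ideal.Quotient.nontrivial_iff.mpr hPmax.ne_top
    rw [Nat.card_eq_two_iff' (0 : 𝓞 L ⧸ P)] at hnorm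
    obtain ⟨y, hy, huniq⟩ := hnorm
    by_cases hx : Ideal.Quotient.mk P x = 0
    · exact Or.inl (Ideal.Quotient.eq_zero_iff_mem.mp hx)
    · right
      rw [← Ideal.Quotient.eq, huniq _ hx, map_one, huniq 1 one_ne_zero]
  have htriv : ∀ g : Gal(L/ℚ), g = 1 := by
    intro g
    have hg3 : g ^ 3 = 1 := by rw [← hcard]; exact pow_card_eq_one'
    have hfix : ∀ x : 𝓞 L, g • x = x := Ideal.smul_eq_of_mem_inertia_of_pow_three hP0 hres hg3
      (by rw [hinert]; trivial)
    ext z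
    obtain ⟨a, b, hb, rfl⟩ := IsFractionRing.div_surjective (A := 𝓞 L) z
    have hg : ∀ a : 𝓞 L, g (algebraMap (𝓞 L) L a) = algebraMap (𝓞 L) L a := fun a =>
      congrArg (algebraMap (𝓞 L) L) (hfix a)
    rw [map_div₀, hg, hg]
    rfl
  have : Subsingleton Gal(L/ℚ) := ⟨fun a b => (htriv a).trans (htriv b).symm⟩
  rw [Nat.card_of_subsingleton 1] at hcard
  omega

/-! ### Roots of the two-torsion polynomial modulo a ramified prime -/

section Valuation

variable {L : Type*} [Field L] [NumberField L] (v : HeightOneSpectrum (𝓞 L))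
  {p : ℕ} [Fact p.Prime]

theorem valuation_natCast_eq_one (hpv : (p : 𝓞 L) ∈ v.asIdeal) {n : ℕ} (hn : ¬ p ∣ n) :
    v.valuation L (n : L) = 1 := by
  have h : (n : 𝓞 L) ∉ v.asIdeal := fun hmem => by
    have hcop : IsCoprime (p : ℤ) (n : ℤ) :=
      Nat.isCoprime_iff_coprime.mpr (((Fact.out : p.Prime).coprime_iff_not_dvd).mpr hn)
    obtain ⟨a, b, hab⟩ := hcop
    have h1 : (1 : 𝓞 L) = a * p + b * n := by exact_mod_cast congrArg (Int.cast (R := 𝓞 L)) hab.symm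
    exact v.isPrime.ne_top ((Ideal.eq_top_iff_one _).mpr
      (h1 ▸ add_mem (Ideal.mul_mem_left _ _ hpv) (Ideal.mul_mem_left _ _ hmem)))
  have := (HeightOneSpectrum.valuation_eq_one_iff_notMem (K := L) v).mpr h
  rwa [map_natCast] at this

theorem valuation_algebraMap_rat_le_one (hpv : (p : 𝓞 L) ∈ v.asIdeal) (r : RatLocalRing p) :
    v.valuation L (algebraMap ℚ L r) ≤ 1 := by
  have hden : ¬ p ∣ (r : ℚ).den := Rat.padicValuation_le_one_iff.mp r.2
  have h1 := valuation_natCast_eq_one v hpv hden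
  have h2 : v.valuation L (((r : ℚ).num : ℤ) : L) ≤ 1 := by
    have : v.valuation L (algebraMap (𝓞 L) L (r : ℚ).num) ≤ 1 := v.valuation_le_one _
    rwa [map_intCast] at this
  have h3 : algebraMap ℚ L r = ((r : ℚ).num : L) / ((r : ℚ).den : L) := by
    conv_lhs => rw [← Rat.num_div_den (r : ℚ)]
    rw [map_div₀, map_intCast, map_natCast]
  rw [h3, map_div₀, h1, div_one]
  exact h2

/-- A unit of the local ring has v-value 1, since its inverse is v-integral too. This brings
divisibility found in L back down to p. -/
theorem maximalIdeal_valuation_lt_one (hpv : (p : 𝓞 L) ∈ v.asIdeal) (r : RatLocalRing p)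
    (hr : v.valuation L (algebraMap ℚ L r) < 1) :
    (IsDiscreteValuationRing.maximalIdeal (RatLocalRing p)).valuation ℚ
      (algebraMap (RatLocalRing p) ℚ r) < 1 := by
  rw [HeightOneSpectrum.valuation_lt_one_iff_mem]
  refine (IsLocalRing.mem_maximalIdeal r).mpr fun hu => ?_
  obtain ⟨s, hs⟩ := hu.exists_right_inv
  have h1 : v.valuation L (algebraMap ℚ L r) * v.valuation L (algebraMap ℚ L s) = 1 := by
    rw [← map_mul, ← map_mul, ← MulMemClass.coe_mul, hs]
    simp
  have h2 := valuation_algebraMap_rat_le_one v hpv s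
  exact absurd h1 ((mul_le_of_le_one_right' h2).trans_lt hr).ne

/-- Inertia is defined by its action on `𝓞 L`; writing x = n / d with d outside the prime extends
triviality on residues to the whole valuation ring. -/
theorem valuation_smul_sub_lt_one {g : Gal(L/ℚ)} (hg : g ∈ v.asIdeal.inertia Gal(L/ℚ)) {x : L}
    (hx : v.valuation L x ≤ 1) : v.valuation L (g x - x) < 1 := by
  obtain ⟨n, d, hnd⟩ := v.exists_primeCompl_mul_eq_of_integer x hx
  have hd : v.valuation L (algebraMap (𝓞 L) L d) = 1 :=
    (HeightOneSpectrum.valuation_eq_one_iff_notMem v).mpr d.2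
  have hg : ∀ y : 𝓞 L, v.valuation L (g (algebraMap (𝓞 L) L y) - algebraMap (𝓞 L) L y) < 1 := by
    intro y
    have h1 : v.valuation L (algebraMap (𝓞 L) L (g • y - y)) < 1 :=
      (v.valuation_lt_one_iff_mem _).mpr (hg y)
    rw [map_sub] at h1
    exact h1
  have hgd : v.valuation L (g (algebraMap (𝓞 L) L d)) = 1 := by
    have h := Valuation.map_add_eq_of_lt_right (v.valuation L)
      (x := g (algebraMap (𝓞 L) L d) - algebraMap (𝓞 L) L d) (y := algebraMap (𝓞 L) L d)
      (by rw [hd]; exact hg d)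
    rwa [sub_add_cancel, hd] at h
  have key : (g x - x) * g (algebraMap (𝓞 L) L d) =
      (g (algebraMap (𝓞 L) L n) - algebraMap (𝓞 L) L n) -
        x * (g (algebraMap (𝓞 L) L d) - algebraMap (𝓞 L) L d) := by
    rw [← hnd, map_mul]; ring
  have h3 : v.valuation L ((g x - x) * g (algebraMap (𝓞 L) L d)) < 1 := by
    rw [key]
    refine Valuation.map_sub_lt _ (hg n) ?_
    rw [map_mul]
    exact (mul_le_of_le_one_left' hx).trans_lt (hg d)
  rwa [map_mul, hgd, mul_one] at h3

end Valuation

/-- Valuation rings are integrally closed: if w z > 1, the term z³ would dominate all the others. -/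
theorem Valuation.le_one_of_monic_cubic {K Γ : Type*} [Field K]
    [LinearOrderedCommGroupWithZero Γ] (w : Valuation K Γ) {a b c z : K} (ha : w a ≤ 1)
    (hb : w b ≤ 1) (hc : w c ≤ 1) (hz : z ^ 3 + a * z ^ 2 + b * z + c = 0) : w z ≤ 1 := by
  by_contra! h
  have h0 : 0 < w z := zero_lt_one.trans h
  have h1 : z ^ 3 = -(a * z ^ 2 + b * z + c) := by linear_combination hz
  have h2 : w (z ^ 3) ≤ w z ^ 2 := by
    rw [h1, Valuation.map_neg]
    refine w.map_add_le (w.map_add_le ?_ ?_) ?_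
    · rw [map_mul, map_pow]
      exact mul_le_of_le_one_left' ha
    · rw [map_mul]
      refine (mul_le_of_le_one_left' hb).trans ?_
      exact le_self_pow₀ h.le (by norm_num)
    · exact hc.trans (one_le_pow₀ h.le)
  rw [map_pow] at h2
  exact absurd h2 (not_le.mpr (pow_lt_pow_right₀ h (by norm_num)))

/-! ### The two-torsion cubic, additive reduction and the conductor -/

namespace WeierstrassCurve

/-- `e` lists the `x`-coordinates of the nonzero `2`-torsion points of `W`, with multiplicity. -/
structure TwoTorsionRoots {K : Type*} [Field K] (W : WeierstrassCurve K) {L : Type*} [Field L]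
    [Algebra K L] (e : Fin 3 → L) : Prop where
  b₂ : algebraMap K L W.b₂ = -4 * (e 0 + e 1 + e 2)
  b₄ : algebraMap K L W.b₄ = 2 * (e 0 * e 1 + e 0 * e 2 + e 1 * e 2)
  b₆ : algebraMap K L W.b₆ = -4 * (e 0 * e 1 * e 2)

namespace TwoTorsionRoots

variable {K : Type*} [Field K] {W : WeierstrassCurve K} {L : Type*} [Field L] [Algebra K L]
  {e : Fin 3 → L} (h : W.TwoTorsionRoots e)

include h

/-- Like Δ, c₄ depends only on root differences; therefore congruent roots make both invariants
vanish modulo the prime. -/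
theorem c₄_eq : algebraMap K L W.c₄ =
    8 * ((e 0 - e 1) ^ 2 + (e 0 - e 2) ^ 2 + (e 1 - e 2) ^ 2) := by
  rw [WeierstrassCurve.c₄, map_sub, map_pow, map_mul, h.b₂, h.b₄, map_ofNat]
  ring

theorem Δ_eq [CharZero L] : algebraMap K L W.Δ =
    16 * ((e 0 - e 1) * (e 0 - e 2) * (e 1 - e 2)) ^ 2 := by
  -- The roots determine b₈ only through 4b₈ = b₂b₆ - b₄², so the identity is proved after
  -- multiplication by 4.
  have h8 : 4 * algebraMap K L W.b₈ =
      algebraMap K L W.b₂ * algebraMap K L W.b₆ - algebraMap K L W.b₄ ^ 2 := by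
    have := congrArg (algebraMap K L) W.b_relation
    simpa only [map_mul, map_sub, map_pow, map_ofNat] using this
  have h4 : 4 * algebraMap K L W.Δ = 4 * (16 * ((e 0 - e 1) * (e 0 - e 2) * (e 1 - e 2)) ^ 2) := by
    simp only [WeierstrassCurve.Δ, map_sub, map_add, map_neg, map_mul, map_pow, map_ofNat]
    rw [h.b₂, h.b₄, h.b₆] at *
    linear_combination (-(-4 * (e 0 + e 1 + e 2)) ^ 2) * h8
  exact mul_left_cancel₀ (by norm_num) h4

/-- Multiplying the cubic by 16 makes it monic in 4x, which gives integrality of 4eᵢ, and of eᵢ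
wherever 4 is a unit. -/
theorem monic_eq (i : Fin 3) : (4 * e i) ^ 3 + algebraMap K L W.b₂ * (4 * e i) ^ 2 +
    (8 * algebraMap K L W.b₄) * (4 * e i) + 16 * algebraMap K L W.b₆ = 0 := by
  rw [h.b₂, h.b₄, h.b₆]
  fin_cases i <;> simp <;> ring

/-- The substitution x = u²x' + r has coefficients in K, so passing to a minimal model leaves the
Galois action on the roots unchanged. -/
theorem variableChange (C : VariableChange K) :
    (C • W).TwoTorsionRoots fun i => algebraMap K L (C.u⁻¹ : Kˣ) ^ 2 *
      (e i - algebraMap K L C.r) := by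
  constructor
  · rw [variableChange_b₂]
    simp only [map_mul, map_pow, map_add, map_ofNat, h.b₂]
    ring
  · rw [variableChange_b₄]
    simp only [map_mul, map_pow, map_add, map_ofNat, h.b₂, h.b₄]
    ring
  · rw [variableChange_b₆]
    simp only [map_mul, map_pow, map_add, map_ofNat, h.b₂, h.b₄, h.b₆]
    ring

end TwoTorsionRoots

/-- If inertia at an odd prime permutes the roots of the two-torsion polynomial of an integral
Weierstrass equation transitively, then the equation has additive reduction. -/
theorem TwoTorsionRoots.valuation_lt_one {L : Type*} [Field L] [NumberField L]
    (v : HeightOneSpectrum (𝓞 L)) {p : ℕ} [Fact p.Prime] (hp2 : p ≠ 2)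
    (hpv : (p : 𝓞 L) ∈ v.asIdeal) {W : WeierstrassCurve ℚ} [W.IsIntegral (RatLocalRing p)]
    {e : Fin 3 → L} (he : W.TwoTorsionRoots e)
    (hI : ∀ i j, i ≠ j → ∃ g ∈ v.asIdeal.inertia Gal(L/ℚ), g (e i) = e j ∨ g (e j) = e i) :
    (IsDiscreteValuationRing.maximalIdeal (RatLocalRing p)).valuation ℚ W.Δ < 1 ∧
      (IsDiscreteValuationRing.maximalIdeal (RatLocalRing p)).valuation ℚ W.c₄ < 1 := by
  have hnat : ∀ n : ℕ, v.valuation L (n : L) ≤ 1 := fun n => by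
    have : v.valuation L (algebraMap (𝓞 L) L n) ≤ 1 := v.valuation_le_one _
    rwa [map_natCast] at this
  have h8 : v.valuation L 8 ≤ 1 := by exact_mod_cast hnat 8
  have h16 : v.valuation L 16 ≤ 1 := by exact_mod_cast hnat 16
  have h4 : v.valuation L 4 = 1 := by
    have hp4 : ¬ p ∣ 4 := fun h => hp2 ((Nat.prime_dvd_prime_iff_eq Fact.out Nat.prime_two).mp
      ((Fact.out : p.Prime).dvd_of_dvd_pow (show p ∣ 2 ^ 2 from h)))
    exact_mod_cast valuation_natCast_eq_one v hpv hp4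
  have hR := valuation_algebraMap_rat_le_one v hpv
  have hb2 : v.valuation L (algebraMap ℚ L W.b₂) ≤ 1 := by
    rw [← integralModel_b₂_eq (RatLocalRing p) W]; exact hR _
  have hb4 : v.valuation L (algebraMap ℚ L W.b₄) ≤ 1 := by
    rw [← integralModel_b₄_eq (RatLocalRing p) W]; exact hR _
  have hb6 : v.valuation L (algebraMap ℚ L W.b₆) ≤ 1 := by
    rw [← integralModel_b₆_eq (RatLocalRing p) W]; exact hR _
  have hint : ∀ i, v.valuation L (e i) ≤ 1 := fun i => by
    have := Valuation.le_one_of_monic_cubic (v.valuation L) hb2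
      (by rw [map_mul]; exact mul_le_one' h8 hb4) (by rw [map_mul]; exact mul_le_one' h16 hb6)
      (he.monic_eq i)
    rwa [map_mul, h4, one_mul] at this
  have hdiff : ∀ i j, i ≠ j → v.valuation L (e i - e j) < 1 := fun i j hij => by
    obtain ⟨g, hg, h | h⟩ := hI i j hij
    · rw [Valuation.map_sub_swap, ← h]
      exact valuation_smul_sub_lt_one v hg (hint i)
    · rw [← h]
      exact valuation_smul_sub_lt_one v hg (hint j)
  have h01 := hdiff 0 1 (by decide)
  have h02 := hdiff 0 2 (by decide)
  have h12 := hdiff 1 2 (by decide)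
  have hsq : ∀ {x : L}, v.valuation L x < 1 → v.valuation L (x ^ 2) < 1 := fun {x} hx => by
    rw [map_pow]; exact pow_lt_one₀ zero_le hx (by norm_num)
  constructor
  · rw [← integralModel_Δ_eq (RatLocalRing p) W]
    refine maximalIdeal_valuation_lt_one v hpv _ ?_
    have : algebraMap ℚ L ((W.integralModel (RatLocalRing p)).Δ : ℚ) = _ :=
      (congrArg (algebraMap ℚ L) (integralModel_Δ_eq (RatLocalRing p) W)).trans he.Δ_eq
    rw [this, map_mul]
    refine (mul_le_of_le_one_left' h16).trans_lt (hsq ?_)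
    rw [map_mul, map_mul]
    exact (mul_le_of_le_one_left' (mul_le_one' h01.le h02.le)).trans_lt h12
  · rw [← integralModel_c₄_eq (RatLocalRing p) W]
    refine maximalIdeal_valuation_lt_one v hpv _ ?_
    have : algebraMap ℚ L ((W.integralModel (RatLocalRing p)).c₄ : ℚ) = _ :=
      (congrArg (algebraMap ℚ L) (integralModel_c₄_eq (RatLocalRing p) W)).trans he.c₄_eq
    rw [this, map_mul]
    exact (mul_le_of_le_one_left' h8).trans_lt
      (Valuation.map_add_lt _ (Valuation.map_add_lt _ (hsq h01) (hsq h02)) (hsq h12))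

/-- Under the hypotheses of `TwoTorsionRoots.valuation_lt_one`, without integrality, the exponent
of the conductor at `p` is at least `2`. -/
theorem TwoTorsionRoots.two_le_conductorExponent {L : Type*} [Field L] [NumberField L]
    (v : HeightOneSpectrum (𝓞 L)) {p : ℕ} [Fact p.Prime] (hp2 : p ≠ 2)
    (hpv : (p : 𝓞 L) ∈ v.asIdeal) {E : WeierstrassCurve ℚ}
    {e : Fin 3 → L} (he : E.TwoTorsionRoots e)
    (hI : ∀ i j, i ≠ j → ∃ g ∈ v.asIdeal.inertia Gal(L/ℚ), g (e i) = e j ∨ g (e j) = e i) :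
    2 ≤ E.conductorExponent p := by
  have he' := he.variableChange (E.exists_isMinimal (RatLocalRing p)).choose
  have hv := TwoTorsionRoots.valuation_lt_one v hp2 hpv (W := E.minimal (RatLocalRing p)) he'
    (by
      intro i j hij
      obtain ⟨g, hg, h⟩ := hI i j hij
      refine ⟨g, hg, h.imp (fun h => ?_) (fun h => ?_)⟩ <;>
        simp only [map_mul, map_pow, map_sub, AlgEquiv.commutes, h])
  -- Good reduction would need Δ to be a unit and multiplicative reduction would need c₄ to be one.
  -- The remaining value is at least 2 whatever the wild part.
  rw [conductorExponent, if_neg fun h => hv.1.ne h.goodReduction,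
    if_neg fun h => hv.2.ne h.multiplicativeReduction]
  omega

/-- Finiteness of the set of contributing primes is essential: a `finprod` with infinite support is
1 by default. -/
theorem sq_dvd_conductor (E : WeierstrassCurve ℚ) [E.IsElliptic] {p : ℕ} [hp : Fact p.Prime]
    (h : 2 ≤ E.conductorExponent p) : p ^ 2 ∣ E.conductor := by
  refine (pow_dvd_pow p h).trans ?_
  exact finprod_mem_dvd (f := fun p : Nat.Primes =>
    haveI : Fact (p : ℕ).Prime := ⟨p.2⟩; (p : ℕ) ^ E.conductorExponent p) (⟨p, hp.out⟩ : Nat.Primes)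
    E.finite_mulSupport_conductor

theorem conductorExponent_lt_two (E : WeierstrassCurve ℚ) [E.IsElliptic] {p : ℕ}
    [hp : Fact p.Prime] (hp2 : p ≠ 2)
    (hN : ∃ r M : ℕ, Odd M ∧ Squarefree M ∧ E.conductor = 2 ^ r * M) :
    E.conductorExponent p < 2 := by
  obtain ⟨r, M, -, hM, hN⟩ := hN
  by_contra! h
  have h1 := E.sq_dvd_conductor h
  rw [hN] at h1
  have h2 : p ^ 2 ∣ M := Nat.Coprime.dvd_of_dvd_mul_left
    (Nat.Coprime.pow _ _ ((Nat.coprime_primes hp.out Nat.prime_two).mpr hp2)) h1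
  rw [pow_two] at h2
  exact hp.out.one_lt.ne' (Nat.isUnit_iff.mp (hM p h2))

end WeierstrassCurve

/-! ### The two-torsion points and the field they generate -/

namespace WeierstrassCurve

namespace TwoTorsionRoots

variable {K : Type*} [Field K] {W : WeierstrassCurve K} {L : Type*} [Field L] [Algebra K L]
  {e : Fin 3 → L} (h : W.TwoTorsionRoots e)

include h

theorem eval_eq (z : L) : 4 * z ^ 3 + algebraMap K L W.b₂ * z ^ 2 + 2 * algebraMap K L W.b₄ * z +
    algebraMap K L W.b₆ = 4 * ((z - e 0) * (z - e 1) * (z - e 2)) := by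
  rw [h.b₂, h.b₄, h.b₆]
  ring

theorem exists_eq_iff [CharZero L] {z : L} : (∃ i, z = e i) ↔ 4 * z ^ 3 +
    algebraMap K L W.b₂ * z ^ 2 + 2 * algebraMap K L W.b₄ * z + algebraMap K L W.b₆ = 0 := by
  rw [h.eval_eq, Fin.exists_fin_succ, Fin.exists_fin_two]
  simp [sub_eq_zero, or_assoc]

theorem exists_map_eq [CharZero L] (f : L →ₐ[K] L) (i : Fin 3) : ∃ j, f (e i) = e j := by
  rw [h.exists_eq_iff]
  have h1 := congrArg f (h.exists_eq_iff.mp ⟨i, rfl⟩)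
  simpa only [map_add, map_mul, map_pow, map_ofNat, AlgHom.commutes, map_zero] using h1

end TwoTorsionRoots

theorem exists_twoTorsionRoots {K : Type*} [Field K] [CharZero K] (W : WeierstrassCurve K)
    [W.IsElliptic] (L : Type*) [Field L] [Algebra K L] [IsAlgClosed L] :
    ∃ e : Fin 3 → L, Function.Injective e ∧ W.TwoTorsionRoots e := by
  have h4 : (4 : K) ≠ 0 := by norm_num
  have ha : W.twoTorsionPolynomial.a ≠ 0 := h4
  obtain ⟨x, y, z, h3⟩ := (Cubic.splits_iff_roots_eq_three ha).mp
    (IsAlgClosed.splits (W.twoTorsionPolynomial.toPoly.map (algebraMap K L)))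
  have hd := (Cubic.discr_ne_zero_iff_roots_ne ha h3).mp
    (W.twoTorsionPolynomial_discr_ne_zero_of_isElliptic (isUnit_iff_ne_zero.mpr two_ne_zero))
  have hs := Cubic.eq_sum_three_roots ha h3
  simp only [Cubic.map, twoTorsionPolynomial, Cubic.mk.injEq, map_mul, map_ofNat, true_and] at hs
  refine ⟨![x, y, z], ?_, ?_, ?_, ?_⟩
  · intro i j hij
    obtain ⟨h1, h2, h3⟩ := hd
    fin_cases i <;> fin_cases j <;> simp_all
  · simp only [Matrix.cons_val]
    linear_combination hs.1
  · have : CharZero L := charZero_of_injective_algebraMap (algebraMap K L).injective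
    refine mul_left_cancel₀ (two_ne_zero (α := L)) ?_
    simp only [Matrix.cons_val]
    linear_combination hs.2.1
  · simp only [Matrix.cons_val]
    linear_combination hs.2.2

section Points

open scoped Classical

variable {K : Type*} [Field K] (E : WeierstrassCurve K) {F : Type*} [Field F] [Algebra K F]

/-- 2P = 0 means P = -P, and negation sends y to -y - a₁x - a₃. -/
theorem some_mem_nTorsion_two_iff {x y : F} (h : (E⁄F).toAffine.Nonsingular x y) :
    Affine.Point.some x y h ∈ E.nTorsion 2 F ↔
      2 * y + algebraMap K F E.a₁ * x + algebraMap K F E.a₃ = 0 := by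
  rw [AddSubgroup.torsionBy.nsmul_iff, two_nsmul, add_eq_zero_iff_eq_neg,
    Affine.Point.neg_some, Affine.Point.some.injEq, Affine.negY]
  simp only [true_and, baseChange, map_a₁, map_a₃]
  constructor <;> intro h <;> linear_combination h

theorem nTorsionRep_some {n : ℕ} (σ : Gal(F/K)) {x y : F} (h : (E⁄F).toAffine.Nonsingular x y)
    (hP : Affine.Point.some x y h ∈ E.nTorsion n F) :
    ∃ h', (E.nTorsionRep n F σ ⟨Affine.Point.some x y h, hP⟩ : (E⁄F).toAffine.Point) =
      Affine.Point.some (σ x) (σ y) h' :=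
  ⟨_, rfl⟩

/-- Completing the square turns the curve into (2y + a₁x + a₃)² = 4x³ + b₂x² + 2b₄x + b₆, and here
the left side is zero. -/
theorem equation_iff_of_two_mul_add [CharZero F] {x y : F}
    (hy : 2 * y + algebraMap K F E.a₁ * x + algebraMap K F E.a₃ = 0) :
    (E⁄F).toAffine.Equation x y ↔ 4 * x ^ 3 + algebraMap K F E.b₂ * x ^ 2 +
      2 * algebraMap K F E.b₄ * x + algebraMap K F E.b₆ = 0 := by
  rw [Affine.equation_iff]
  simp only [baseChange, map_a₁, map_a₂, map_a₃, map_a₄, map_a₆, b₂, b₄, b₆, map_add, map_mul,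
    map_pow, map_ofNat]
  have h4 : (4 : F) ≠ 0 := by norm_num
  constructor
  · intro h
    linear_combination (-4) * h + (2 * y + algebraMap K F E.a₁ * x + algebraMap K F E.a₃) * hy
  · intro h
    refine mul_left_cancel₀ h4 ?_
    linear_combination (-1) * h + (2 * y + algebraMap K F E.a₁ * x + algebraMap K F E.a₃) * hy

end Points

/-- The nonzero `2`-torsion points over an algebraically closed field, as Galois set. -/
theorem exists_twoTorsion_points {K : Type*} [Field K] [CharZero K] (E : WeierstrassCurve K)
    [E.IsElliptic] (F : Type*) [Field F] [Algebra K F] [IsAlgClosed F] :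
    ∃ (e : Fin 3 → F) (T : Fin 3 → E.nTorsion 2 F), Function.Injective e ∧ E.TwoTorsionRoots e ∧
      (∀ i, T i ≠ 0) ∧ (∀ P, P = 0 ∨ ∃ i, P = T i) ∧
      (∀ (σ : Gal(F/K)) (i j : Fin 3), E.nTorsionRep 2 F σ (T i) = T j ↔ σ (e i) = e j) ∧
      IntermediateField.adjoin K {z | ∃ (x y : F) (h : (E⁄F).toAffine.Nonsingular x y),
        Affine.Point.some x y h ∈ E.nTorsion 2 F ∧ (z = x ∨ z = y)} =
          IntermediateField.adjoin K (Set.range e) := by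
  classical
  have : CharZero F := charZero_of_injective_algebraMap (algebraMap K F).injective
  obtain ⟨e, hinj, he⟩ := E.exists_twoTorsionRoots F
  -- The y-coordinate of a 2-torsion point is a K-rational function of x, so it follows the Galois
  -- action on x and adds nothing to the field.
  set Y : F → F := fun x => -(algebraMap K F E.a₁ * x + algebraMap K F E.a₃) / 2 with hY
  have hY2 : ∀ x y, 2 * y + algebraMap K F E.a₁ * x + algebraMap K F E.a₃ = 0 ↔ y = Y x := by
    intro x y
    rw [hY, eq_div_iff two_ne_zero]
    constructor <;> intro h <;> linear_combination h
  have : (E⁄F).toAffine.IsElliptic := inferInstanceAs (E.map (algebraMap K F)).IsElliptic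
  have hns : ∀ i, (E⁄F).toAffine.Nonsingular (e i) (Y (e i)) := fun i =>
    Affine.equation_iff_nonsingular.mp ((E.equation_iff_of_two_mul_add ((hY2 _ _).mpr rfl)).mpr
      (he.exists_eq_iff.mp ⟨i, rfl⟩))
  have hmem : ∀ i, Affine.Point.some (e i) (Y (e i)) (hns i) ∈ E.nTorsion 2 F := fun i =>
    (E.some_mem_nTorsion_two_iff _).mpr ((hY2 _ _).mpr rfl)
  have hall : ∀ {x y : F} (h : (E⁄F).toAffine.Nonsingular x y),
      Affine.Point.some x y h ∈ E.nTorsion 2 F → ∃ i, x = e i ∧ y = Y (e i) := by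
    intro x y h hP
    have hy := (E.some_mem_nTorsion_two_iff h).mp hP
    obtain ⟨i, rfl⟩ := he.exists_eq_iff.mpr ((E.equation_iff_of_two_mul_add hy).mp h.1)
    exact ⟨i, rfl, (hY2 _ _).mp hy⟩
  refine ⟨e, fun i => ⟨Affine.Point.some (e i) (Y (e i)) (hns i), hmem i⟩, hinj, he, ?_, ?_, ?_, ?_⟩
  · intro i h
    exact Affine.Point.some_ne_zero _ (congrArg Subtype.val h)
  · rintro ⟨_ | ⟨x, y, h⟩, hP⟩
    · exact Or.inl rfl
    · obtain ⟨i, rfl, rfl⟩ := hall h hP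
      exact Or.inr ⟨i, rfl⟩
  · intro σ i j
    obtain ⟨h', hσ⟩ := E.nTorsionRep_some σ (hns i) (hmem i)
    rw [Subtype.ext_iff, hσ]
    constructor
    · intro h
      exact (Affine.Point.some.inj h).1
    · intro h
      have h2 : σ (Y (e i)) = Y (e j) := by
        rw [← h, hY]
        simp only [map_div₀, map_neg, map_add, map_mul, AlgEquiv.commutes, map_ofNat]
      simp only [h, h2]
  · apply le_antisymm
    · rw [IntermediateField.adjoin_le_iff]
      rintro z ⟨x, y, h, hP, hz⟩
      obtain ⟨i, rfl, rfl⟩ := hall h hP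
      have hei : e i ∈ IntermediateField.adjoin K (Set.range e) :=
        IntermediateField.subset_adjoin _ _ ⟨i, rfl⟩
      rcases hz with rfl | rfl
      · exact hei
      · rw [hY]
        exact div_mem (neg_mem (add_mem (mul_mem (algebraMap_mem _ _) hei) (algebraMap_mem _ _)))
          (ofNat_mem _ 2)
    · rw [IntermediateField.adjoin_le_iff]
      rintro _ ⟨i, rfl⟩
      exact IntermediateField.subset_adjoin _ _ ⟨_, _, hns i, hmem i, Or.inl rfl⟩

/-- The roots of the two-torsion polynomial of a curve that is semistable outside `2` do not
generate a cyclic cubic field. -/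
theorem TwoTorsionRoots.finrank_ne_three {E : WeierstrassCurve ℚ} [E.IsElliptic]
    (hN : ∃ r M : ℕ, Odd M ∧ Squarefree M ∧ E.conductor = 2 ^ r * M)
    {L : Type*} [Field L] [alg : Algebra ℚ L] [FiniteDimensional ℚ L] [IsGalois ℚ L] {e : Fin 3 → L}
    (hinj : Function.Injective e) (he : E.TwoTorsionRoots e)
    (hfaith : ∀ g : Gal(L/ℚ), (∀ i, g (e i) = e i) → g = 1) : Module.finrank ℚ L ≠ 3 := by
  intro h3
  have : CharZero L := charZero_of_injective_algebraMap (algebraMap ℚ L).injective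
  -- An intermediate field brings its own ℚ-algebra structure, whereas `NumberField` uses the
  -- canonical one; the two agree by uniqueness.
  obtain rfl : alg = DivisionRing.toRatAlgebra := Subsingleton.elim _ _
  have : NumberField L := ⟨⟩
  obtain ⟨p, hp, hp2, P, hPmax, hpP, hI⟩ := NumberField.exists_odd_prime_inertia_eq_top L h3
  have : Fact p.Prime := ⟨hp⟩
  have hP0 : P ≠ ⊥ := by
    rintro rfl
    simp [hp.ne_zero] at hpP
  have hcard : Nat.card Gal(L/ℚ) = 3 := by rw [IsGalois.card_aut_eq_finrank, h3]
  have : Nontrivial Gal(L/ℚ) := by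
    rw [← Finite.one_lt_card_iff_nontrivial, hcard]; norm_num
  obtain ⟨g, hg⟩ := exists_ne (1 : Gal(L/ℚ))
  have hg3 : g ^ 3 = 1 := by rw [← hcard]; exact pow_card_eq_one'
  choose f hf using he.exists_map_eq (g : L →ₐ[ℚ] L)
  have hf : ∀ i, g (e i) = e (f i) := hf
  have hfinj : Function.Injective f := fun i j hij => hinj (g.injective (by rw [hf, hf, hij]))
  have hffix : ∀ i, f i ≠ i := by
    intro i hi
    -- A permutation of three letters with a fixed point is an involution; then g² = 1 and g³ = 1
    -- give g = 1.
    have hff : ∀ f : Fin 3 → Fin 3, Function.Injective f → ∀ i, f i = i → ∀ j, f (f j) = j := by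
      decide
    have hg2 : g ^ 2 = 1 := hfaith _ fun j => by
      rw [pow_two, AlgEquiv.mul_apply, hf, hf, hff f hfinj i hi]
    rw [pow_succ, hg2, one_mul] at hg3
    exact hg hg3
  -- A permutation of three letters without fixed points is a 3-cycle, so it carries one of any two
  -- letters to the other.
  have hcyc : ∀ f : Fin 3 → Fin 3, Function.Injective f → (∀ i, f i ≠ i) →
      ∀ i j, i ≠ j → f i = j ∨ f j = i := by decide
  have h2 := TwoTorsionRoots.two_le_conductorExponent ⟨P, hPmax.isPrime, hP0⟩ hp2 hpP he
    (fun i j hij => ⟨g, by change g ∈ P.inertia _; rw [hI]; trivial,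
      (hcyc f hfinj hffix i j hij).imp (fun h => by rw [hf, h]) (fun h => by rw [hf, h])⟩)
  exact absurd (E.conductorExponent_lt_two hp2 hN) (not_lt.mpr h2)

theorem TwoTorsionRoots.isGalois_adjoin {K : Type*} [Field K] [CharZero K]
    {W : WeierstrassCurve K} {F : Type*} [Field F] [Algebra K F] [Normal K F] {e : Fin 3 → F}
    (he : W.TwoTorsionRoots e) : IsGalois K (IntermediateField.adjoin K (Set.range e)) := by
  have : CharZero F := charZero_of_injective_algebraMap (algebraMap K F).injective
  have : Normal K (IntermediateField.adjoin K (Set.range e)) := by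
    rw [IntermediateField.normal_iff_forall_map_le]
    intro σ
    rw [IntermediateField.adjoin_map, IntermediateField.adjoin_le_iff]
    rintro _ ⟨_, ⟨i, rfl⟩, rfl⟩
    obtain ⟨j, hj⟩ := he.exists_map_eq σ i
    exact IntermediateField.subset_adjoin _ _ ⟨j, hj.symm⟩
  exact ⟨⟩

theorem TwoTorsionRoots.codRestrict_adjoin {K : Type*} [Field K]
    {W : WeierstrassCurve K} {F : Type*} [Field F] [Algebra K F] {e : Fin 3 → F}
    (he : W.TwoTorsionRoots e) :
    W.TwoTorsionRoots (Set.codRestrict e (IntermediateField.adjoin K (Set.range e))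
      fun i => IntermediateField.subset_adjoin K _ ⟨i, rfl⟩) :=
  ⟨Subtype.ext he.b₂, Subtype.ext he.b₄, Subtype.ext he.b₆⟩

theorem _root_.IntermediateField.algEquiv_adjoin_range_eq_one {K F ι : Type*} [Field K] [Field F]
    [Algebra K F] {e : ι → F} (g : Gal(IntermediateField.adjoin K (Set.range e)/K))
    (hg : ∀ i, g (Set.codRestrict e (IntermediateField.adjoin K (Set.range e))
      (fun i => IntermediateField.subset_adjoin K _ ⟨i, rfl⟩) i) =
        Set.codRestrict e (IntermediateField.adjoin K (Set.range e))
          (fun i => IntermediateField.subset_adjoin K _ ⟨i, rfl⟩) i) :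
    g = 1 := by
  have h : (g : _ →ₐ[K] _) = AlgHom.id K (IntermediateField.adjoin K (Set.range e)) := by
    refine IntermediateField.adjoin_algHom_ext K ?_
    rintro _ ⟨i, rfl⟩
    exact hg i
  exact AlgEquiv.ext fun z => DFunLike.congr_fun h z

/-- The same for roots in a larger field. -/
theorem TwoTorsionRoots.finrank_adjoin_ne_three {E : WeierstrassCurve ℚ} [E.IsElliptic]
    (hN : ∃ r M : ℕ, Odd M ∧ Squarefree M ∧ E.conductor = 2 ^ r * M)
    {F : Type*} [Field F] [Algebra ℚ F] [Normal ℚ F] {e : Fin 3 → F}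
    (hinj : Function.Injective e) (he : E.TwoTorsionRoots e) :
    Module.finrank ℚ (IntermediateField.adjoin ℚ (Set.range e)) ≠ 3 := by
  intro h3
  have : FiniteDimensional ℚ (IntermediateField.adjoin ℚ (Set.range e)) :=
    Module.finite_of_finrank_pos (by omega)
  have := he.isGalois_adjoin
  exact TwoTorsionRoots.finrank_ne_three hN
    (alg := (IntermediateField.adjoin ℚ (Set.range e)).algebra')
    (fun i j hij => hinj (congrArg Subtype.val hij)) he.codRestrict_adjoin
    IntermediateField.algEquiv_adjoin_range_eq_one h3

end WeierstrassCurve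

/-! ### Representations on a vector space of four elements -/

theorem Fin.exists_third {i j : Fin 3} (h : i ≠ j) :
    ∃ k, k ≠ i ∧ k ≠ j ∧ ∀ l, l = i ∨ l = j ∨ l = k := by
  decide +revert

theorem ZMod.two_smul_eq {V : Type*} [AddCommGroup V] [Module (ZMod 2) V] (a : ZMod 2) (v : V) :
    a • v = 0 ∨ a • v = v := by
  have : a = 0 ∨ a = 1 := by decide +revert
  rcases this with rfl | rfl <;> simp

namespace Representation

variable {G V : Type*} [Group G] [AddCommGroup V] [Module (ZMod 2) V]
  {ρ : Representation (ZMod 2) G V} {T : Fin 3 → V}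

theorem apply_injective (g : G) : Function.Injective (ρ g) := fun x y h => by
  simpa using congrArg (ρ g⁻¹) h

/-- A vector fixed by the whole group spans an invariant line, which over F₂ has only one nonzero
vector and so is proper. -/
theorem exists_apply_ne_of_not_isReducible (hT : Function.Injective T) (hT0 : ∀ i, T i ≠ 0)
    (h : ¬ ρ.IsReducible) (k : Fin 3) : ∃ g, ρ g (T k) ≠ T k := by
  by_contra! hk
  refine h ⟨⟨Submodule.span (ZMod 2) {T k}, ?_⟩, ?_, ?_⟩
  · intro g v hv
    obtain ⟨a, rfl⟩ := Submodule.mem_span_singleton.mp hv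
    rw [map_smul, hk]
    exact hv
  · simpa using hT0 k
  · intro htop
    obtain ⟨j, hj⟩ := exists_ne k
    obtain ⟨a, ha⟩ := Submodule.mem_span_singleton.mp (htop ▸ Submodule.mem_top : T j ∈ _)
    rcases ZMod.two_smul_eq a (T k) with h0 | h1
    · exact hT0 j (ha.symm.trans h0)
    · exact hj (hT (ha.symm.trans h1))

section

variable (hT0 : ∀ i, T i ≠ 0) (hall : ∀ v, v = 0 ∨ ∃ i, v = T i)

include hT0 hall

theorem exists_apply_eq (g : G) (i : Fin 3) : ∃ j, ρ g (T i) = T j :=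
  (hall _).resolve_left fun h => hT0 i (apply_injective g (h.trans (map_zero _).symm))

/-- No nonzero vector is fixed by the group. If `T i` never reached `T j`, both would have to move
to the third vector, and going there from `T i` and back to `T j` is a contradiction. -/
theorem exists_apply_eq_of_not_isReducible (hT : Function.Injective T)
    (h : ¬ ρ.IsReducible) (i j : Fin 3) : ∃ g, ρ g (T i) = T j := by
  by_cases hij : i = j
  · exact ⟨1, by simp [hij]⟩
  by_contra! hno
  obtain ⟨k, hki, hkj, hl⟩ := Fin.exists_third hij
  obtain ⟨g, hg⟩ := exists_apply_ne_of_not_isReducible hT hT0 h i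
  obtain ⟨g', hg'⟩ := exists_apply_ne_of_not_isReducible hT hT0 h j
  have h1 : ρ g (T i) = T k := by
    obtain ⟨l, hgl⟩ := exists_apply_eq (ρ := ρ) hT0 hall g i
    rcases hl l with rfl | rfl | rfl
    · exact absurd hgl hg
    · exact absurd hgl (hno g)
    · exact hgl
  have h2 : ρ g' (T j) = T k := by
    obtain ⟨l, hgl⟩ := exists_apply_eq (ρ := ρ) hT0 hall g' j
    rcases hl l with rfl | rfl | rfl
    · exact absurd (by rw [← hgl]; simp) (hno g'⁻¹)
    · exact absurd hgl hg'
    · exact hgl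
  refine hno (g'⁻¹ * g) ?_
  rw [map_mul, Module.End.mul_apply, h1, ← h2]
  simp

theorem add_eq_of_ne (hT : Function.Injective T) {i j k : Fin 3} (hij : i ≠ j)
    (hl : ∀ l, l = i ∨ l = j ∨ l = k) : T i + T j = T k := by
  rcases hall (T i + T j) with h | ⟨l, h⟩
  · refine absurd (hT ?_) hij
    rw [eq_neg_of_add_eq_zero_left h]
    have : (2 : ZMod 2) • T j = 0 := by rw [show (2 : ZMod 2) = 0 from rfl, zero_smul]
    rw [two_smul] at this
    exact (eq_neg_of_add_eq_zero_left this).symm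
  · rcases hl l with rfl | rfl | rfl
    · exact absurd (by simpa using h) (hT0 j)
    · exact absurd (by simpa using h) (hT0 i)
    · exact h

/-- A transitive action on the nonzero vectors of a plane over the field of two elements is
absolutely irreducible as soon as some transposition is in the image. -/
theorem isAbsolutelyIrreducible_of_transposition (hT : Function.Injective T)
    (htrans : ∀ i j, ∃ g, ρ g (T i) = T j) {g : G} {i j : Fin 3} (hi : ρ g (T i) = T i)
    (hj : ρ g (T j) ≠ T j) : ρ.IsAbsolutelyIrreducible := by
  set F := AlgebraicClosure (ZMod 2)
  have hji : j ≠ i := by rintro rfl; exact hj hi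
  obtain ⟨k, hkj, hki, hl⟩ := Fin.exists_third hji
  have hgj : ρ g (T j) = T k := by
    obtain ⟨l, hgl⟩ := exists_apply_eq (ρ := ρ) hT0 hall g j
    rcases hl l with rfl | rfl | rfl
    · exact absurd hgl hj
    · exact absurd (hT (apply_injective g (hgl.trans hi.symm))) hji
    · exact hgl
  have hgk : ρ g (T k) = T j := by
    obtain ⟨l, hgl⟩ := exists_apply_eq (ρ := ρ) hT0 hall g k
    rcases hl l with rfl | rfl | rfl
    · exact hgl
    · exact absurd (hT (apply_injective g (hgl.trans hi.symm))) hki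
    · exact absurd (hT (apply_injective g (hgl.trans hgj.symm))) hkj
  have hsum : T j + T k = T i :=
    add_eq_of_ne hT0 hall hT hkj.symm fun l => by have := hl l; tauto
  have hext : ∀ (h : G) (a : F) (v : V), ρ.extendScalars F h (a ⊗ₜ[ZMod 2] v) =
      a ⊗ₜ[ZMod 2] ρ h v := fun h a v => LinearMap.baseChange_tmul ..
  have hrep : ∀ v : F ⊗[ZMod 2] V, ∃ a b : F, v = a ⊗ₜ T j + b ⊗ₜ T k := by
    intro v
    induction v with
    | zero => exact ⟨0, 0, by simp⟩
    | add x y hx hy =>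
      obtain ⟨a, b, rfl⟩ := hx
      obtain ⟨a', b', rfl⟩ := hy
      exact ⟨a + a', b + b', by rw [TensorProduct.add_tmul, TensorProduct.add_tmul]; abel⟩
    | tmul a v =>
      rcases hall v with rfl | ⟨l, rfl⟩
      · exact ⟨0, 0, by simp⟩
      · rcases hl l with rfl | rfl | rfl
        · exact ⟨a, 0, by simp⟩
        · exact ⟨a, a, by rw [← TensorProduct.tmul_add, hsum]⟩
        · exact ⟨0, a, by simp⟩
  have : Nontrivial V := ⟨⟨T i, 0, hT0 i⟩⟩
  have hnt : Nontrivial (F ⊗[ZMod 2] V) := inferInstance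
  -- By transitivity, an invariant subspace containing a nonzero multiple of one `T i` contains
  -- every `T l`, and these span.
  have hUtop : ∀ (U : Subrepresentation (ρ.extendScalars F)) (c : F), c ≠ 0 →
      c ⊗ₜ T i ∈ U.toSubmodule → U = ⊤ := by
    intro U c hc hcU
    have h1 : ∀ (a : F) (l : Fin 3), a ⊗ₜ T l ∈ U.toSubmodule := by
      intro a l
      obtain ⟨h, hh⟩ := htrans i l
      have := U.toSubmodule.smul_mem (a * c⁻¹) (U.apply_mem_toSubmodule h hcU)
      rwa [hext, hh, TensorProduct.smul_tmul', smul_eq_mul, mul_assoc, inv_mul_cancel₀ hc,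
        mul_one] at this
    apply Subrepresentation.toSubmodule_injective
    refine (Submodule.eq_top_iff').mpr fun v => ?_
    obtain ⟨a, b, rfl⟩ := hrep v
    exact add_mem (h1 a j) (h1 b k)
  refine @IsSimpleOrder.mk _ _ _ ⟨⟨⊥, ⊤, fun h => ?_⟩⟩ fun U => ?_
  · exact bot_ne_top (α := Submodule F (F ⊗[ZMod 2] V))
      (congrArg Subrepresentation.toSubmodule h)
  · by_cases hU : U.toSubmodule = ⊥
    · exact Or.inl (Subrepresentation.toSubmodule_injective hU)
    · right
      obtain ⟨v, hv, hv0⟩ := (Submodule.ne_bot_iff _).mp hU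
      obtain ⟨a, b, rfl⟩ := hrep v
      have h1 := U.apply_mem_toSubmodule g hv
      rw [map_add, hext, hext, hgj, hgk] at h1
      -- For v = a ⊗ `T j` + b ⊗ `T k`, adding the transposed vector gives (a + b) ⊗ `T i`. If a + b
      -- = 0, characteristic 2 gives a = b and v itself is a multiple of `T i`.
      have h2 := add_mem hv h1
      have h3 : a ⊗ₜ[ZMod 2] T j + b ⊗ₜ[ZMod 2] T k + (a ⊗ₜ T k + b ⊗ₜ T j) =
          (a + b) ⊗ₜ T i := by
        rw [← hsum, TensorProduct.add_tmul, TensorProduct.tmul_add, TensorProduct.tmul_add]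
        abel
      rw [h3] at h2
      by_cases hab : a + b = 0
      · have hb : b = a := by
          rw [eq_neg_of_add_eq_zero_right hab, CharTwo.neg_eq]
        subst hb
        rw [← TensorProduct.tmul_add, hsum] at hv hv0
        refine hUtop U b ?_ hv
        rintro rfl
        simp at hv0
      · exact hUtop U _ hab h2

end

end Representation

/-! ### A transitive action without transpositions gives a cubic field -/

namespace WeierstrassCurve

/-- An automorphism fixing one root fixes all, so by Galois correspondence `e 0` alone generates the
field. Its degree is at most 3 by the cubic, and at least 3 because transitivity makes all three
distinct roots conjugate. -/
theorem TwoTorsionRoots.finrank_adjoin_eq_three {K : Type*} [Field K] [CharZero K]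
    {W : WeierstrassCurve K} {F : Type*} [Field F] [Algebra K F] [IsGalois K F] {e : Fin 3 → F}
    (hinj : Function.Injective e) (he : W.TwoTorsionRoots e)
    (htrans : ∀ i j, ∃ σ : Gal(F/K), σ (e i) = e j)
    (hfree : ∀ (σ : Gal(F/K)) (i : Fin 3), σ (e i) = e i → ∀ j, σ (e j) = e j) :
    Module.finrank K (IntermediateField.adjoin K (Set.range e)) = 3 := by
  classical
  have : CharZero F := charZero_of_injective_algebraMap (algebraMap K F).injective
  have heq : IntermediateField.adjoin K (Set.range e) = IntermediateField.adjoin K {e 0} := by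
    apply le_antisymm
    · rw [IntermediateField.adjoin_le_iff]
      rintro _ ⟨j, rfl⟩
      rw [SetLike.mem_coe, ← InfiniteGalois.fixedField_fixingSubgroup
        (IntermediateField.adjoin K {e 0}), IntermediateField.mem_fixedField_iff]
      intro σ hσ
      exact hfree σ 0 ((IntermediateField.mem_fixingSubgroup_iff _ _).mp hσ _
        (IntermediateField.mem_adjoin_simple_self K (e 0))) j
    · exact IntermediateField.adjoin.mono _ _ _ (by rintro _ rfl; exact ⟨0, rfl⟩)
  have hint : _root_.IsIntegral K (e 0) := Algebra.IsIntegral.isIntegral _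
  rw [heq, IntermediateField.adjoin.finrank hint]
  apply le_antisymm
  · have ha : W.twoTorsionPolynomial.a ≠ 0 := by
      change (4 : K) ≠ 0
      norm_num
    refine (Polynomial.natDegree_le_of_dvd (minpoly.dvd K _ ?_)
      (Cubic.ne_zero_of_a_ne_zero ha)).trans_eq (Cubic.natDegree_of_a_ne_zero ha)
    have := he.exists_eq_iff.mp ⟨0, rfl⟩
    simpa only [Cubic.toPoly, twoTorsionPolynomial, map_add, map_mul, map_pow, Polynomial.aeval_C,
      Polynomial.aeval_X, map_ofNat] using this
  · have hroot : ∀ i, Polynomial.aeval (e i) (minpoly K (e 0)) = 0 := fun i => by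
      obtain ⟨σ, hσ⟩ := htrans 0 i
      rw [← hσ, Polynomial.aeval_algHom_apply, minpoly.aeval, map_zero]
    have hcard := Polynomial.card_le_degree_of_subset_roots
      (p := (minpoly K (e 0)).map (algebraMap K F)) (Z := Finset.univ.image e) (by
        intro z hz
        obtain ⟨i, -, rfl⟩ := Finset.mem_image.mp (Finset.mem_val.mp hz)
        rw [Polynomial.mem_roots ((Polynomial.map_ne_zero_iff (algebraMap K F).injective).mpr
          (minpoly.ne_zero hint)), Polynomial.IsRoot.def, Polynomial.eval_map_algebraMap]
        exact hroot i)
    rwa [Finset.card_image_of_injective _ hinj, Finset.card_univ, Fintype.card_fin,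
      Polynomial.natDegree_map] at hcard

end WeierstrassCurve

end

theorem proposition2p1 (E : WeierstrassCurve ℚ) [E.IsElliptic]
    (hN : ∃ r M : ℕ, Odd M ∧ Squarefree M ∧ E.conductor = 2 ^ r * M) :
    ((E.galoisRep 2).IsReducible ∨ (E.galoisRep 2).IsAbsolutelyIrreducible) ∧
      Module.finrank ℚ (E.divisionField 2) ≠ 3 := by
  obtain ⟨e, T, hinj, he, hT0, hall, hrep, hadj⟩ :=
    E.exists_twoTorsion_points (AlgebraicClosure ℚ)
  have hgal : IsGalois ℚ (AlgebraicClosure ℚ) := by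
    convert! (⟨⟩ : @IsGalois ℚ _ (AlgebraicClosure ℚ) _ (AlgebraicClosure.instAlgebra ..))
  have hne := WeierstrassCurve.TwoTorsionRoots.finrank_adjoin_ne_three hN hinj he
  refine ⟨or_iff_not_imp_left.mpr fun hred => ?_, ?_⟩
  · have hT : Function.Injective T := fun i j hij => hinj <| by
      have := (hrep 1 i j).mp (by rw [map_one, hij]; rfl)
      exact this
    have htrans := Representation.exists_apply_eq_of_not_isReducible hT0 hall hT hred
    -- If absolute irreducibility fails, no automorphism fixes one root and moves another, which is
    -- exactly the freeness that yields a field of degree 3.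
    by_contra hirr
    refine hne (he.finrank_adjoin_eq_three hinj
      (fun i j => (htrans i j).imp fun σ hσ => (hrep σ i j).mp hσ) fun σ i hi j => ?_)
    by_contra hj
    exact hirr (Representation.isAbsolutelyIrreducible_of_transposition hT0 hall hT htrans
      ((hrep σ i i).mpr hi) fun h => hj ((hrep σ j j).mp h))
  · rw [WeierstrassCurve.divisionField, hadj]
    exact hne
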